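/- There is an integer $N$ such that the following holds. Let $G$ be a finite simple connected $4$-regular graph of order $n\ge N$ that has a vertex $x$ for which the subgraph $G[N_G(x)]$ induced by the neighborhood of $x$ is not isomorphic to $2K_2$ (the disjoint union of two copies of $K_2$). Then $G$ is isomorphic to the square $C_n^2$ of the cycle $C_n$ (the graph on $V(C_n)$ in which two distinct vertices are adjacent if their distance in $C_n$ is at most $2$), or $G$ has a minimal cutset $S$ with $|S|\le 4$ such that the average degree of the induced subgraph $G[S]$ is less than $1$. Here a set $S$ of vertices is a cutset of $G$ if $G-S$ is disconnected, and a cutset is minimal if no proper subset of it is a cutset. -/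

import Mathlib

namespace SimpleGraph

/-- A set `S` of vertices is a cutset of `G` if `G - S` is disconnected, that is, some two
vertices outside `S` are not joined by a walk in `G - S`. -/
def IsCutset {V : Type*} (G : SimpleGraph V) (S : Finset V) : Prop :=
  ¬ (G.induce ((S : Set V)ᶜ)).Preconnected

/-- A minimal cutset: a cutset no proper subset of which is a cutset. -/
def IsMinimalCutset {V : Type*} (G : SimpleGraph V) (S : Finset V) : Prop :=
  Minimal (fun T : Finset V => G.IsCutset T) S

/-- The average degree of a finite graph. -/
def avgDegree {W : Type*} [Fintype W] (H : SimpleGraph W) [DecidableRel H.Adj] : ℚ :=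
  (∑ w : W, (H.degree w : ℚ)) / (Fintype.card W : ℚ)

/-- The average degree of the subgraph `G[S]` of `G` induced by `S`. -/
def avgDegreeOn {V : Type*} (G : SimpleGraph V) [DecidableRel G.Adj] (S : Finset V) : ℚ :=
  (G.induce (S : Set V)).avgDegree

/-- The square of a graph: distinct vertices are adjacent if they are adjacent in `H` or have a
common neighbor in `H`, that is, if they are at distance at most two in `H`. -/
def square {W : Type*} (H : SimpleGraph W) : SimpleGraph W where
  Adj u v := u ≠ v ∧ (H.Adj u v ∨ ∃ w, H.Adj u w ∧ H.Adj w v)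
  symm := ⟨by
    rintro u v ⟨hne, h | ⟨w, h1, h2⟩⟩
    · exact ⟨hne.symm, Or.inl h.symm⟩
    · exact ⟨hne.symm, Or.inr ⟨w, h2.symm, h1.symm⟩⟩⟩
  loopless := ⟨fun _ h => h.1 rfl⟩

/-- The graph `2K₂`: the disjoint union of two copies of the complete graph on two vertices. -/
def twoK2 : SimpleGraph (Fin 2 ⊕ Fin 2) :=
  completeGraph (Fin 2) ⊕g completeGraph (Fin 2)

end SimpleGraph

/-!
Suppose that every minimal cutset of at most four vertices spans a subgraph of average degree at
least one, and let `S` be a smallest separator, cutting off as few vertices as possible. If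
`#S ≤ 3`, every vertex of `S` has at least two neighbors on the small side and one on the other,
hence at most one in `S`; so `S` consists of two adjacent vertices. Their single neighbors on the
large side must coincide, and this common neighbor is then a smaller separator, a contradiction.
Therefore every separator has at least four vertices, and one with exactly four spans at least two
edges.

Applied to the sets that surround a vertex `x` and some of its neighbors, this leaves only `2K₂`
and a path `a b c d` for the graph induced on the neighborhood of `x`; in the second case `c` in
turn has the induced path `b x d e` as its neighborhood. Continuing in this way yields a sequence
of vertices that looks locally like the square of a two-way infinite path. By connectedness it runs
through all vertices, and a shortest return shows that it is periodic and injective modulo its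
period.
-/

section SmallSeparators

open Finset SimpleGraph

variable {V : Type*} {G : SimpleGraph V}

theorem mem_of_preconnected (hG : G.Preconnected) {s : Set V} {u : V} (hu : u ∈ s)
    (hs : ∀ v ∈ s, ∀ w, G.Adj v w → w ∈ s) (w : V) : w ∈ s := by
  by_contra hw
  obtain ⟨p⟩ := hG u w
  obtain ⟨e, -, hfst, hsnd⟩ := p.exists_boundary_dart s hu hw
  exact hsnd (hs _ hfst _ e.adj)

/-- Every edge of `G` leaving `W` ends in `S`, so that `S` cuts `W` off from the rest of `G`.
The sets need not be disjoint. -/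
def Encloses (G : SimpleGraph V) (S W : Finset V) : Prop :=
  ∀ w ∈ W, ∀ v, G.Adj w v → v ∈ W ∨ v ∈ S

/-- The set `A` is a union of components of `G - S`, but neither empty nor all of `G - S`. -/
structure Separates (G : SimpleGraph V) (S A : Finset V) : Prop where
  nonempty : A.Nonempty
  disjoint : Disjoint A S
  exists_notMem : ∃ v, v ∉ A ∧ v ∉ S
  encloses : Encloses G S A

namespace Separates

variable {S A : Finset V}

theorem isCutset (h : Separates G S A) : G.IsCutset S := by
  intro hS
  obtain ⟨a, ha⟩ := h.nonempty
  obtain ⟨b, hbA, hbS⟩ := h.exists_notMem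
  refine hbA (mem_of_preconnected hS (s := {v | (v : V) ∈ A})
    (u := ⟨a, Finset.disjoint_left.1 h.disjoint ha⟩) ha ?_ ⟨b, hbS⟩)
  exact fun v hv w hvw => (h.encloses v hv w hvw).resolve_right w.2

theorem left_nonempty (h : Separates G S A) (hG : G.Preconnected) : S.Nonempty := by
  by_contra hS
  obtain ⟨a, ha⟩ := h.nonempty
  obtain ⟨b, hbA, -⟩ := h.exists_notMem
  refine hbA (mem_of_preconnected hG (s := {v | v ∈ A}) ha ?_ b)
  exact fun v hv w hvw => (h.encloses v hv w hvw).resolve_right fun hw => hS ⟨w, hw⟩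

theorem lt_card_add_card [G.LocallyFinite] {d : ℕ} (h : Separates G S A)
    (hG : G.IsRegularOfDegree d) : d < #A + #S := by
  classical
  obtain ⟨a, ha⟩ := h.nonempty
  have hsub : insert a (G.neighborFinset a) ⊆ A ∪ S := by
    intro v hv
    have := h.encloses a ha v
    grind [mem_neighborFinset]
  calc d < #(insert a (G.neighborFinset a)) := by
        simp [card_insert_of_notMem, hG.degree_eq]
    _ ≤ #(A ∪ S) := card_le_card hsub
    _ ≤ #A + #S := card_union_le A S

variable [DecidableEq V]

theorem advance (h : Separates G S A) {R T : Finset V} (hT : T ⊆ A) (hAT : (A \ T).Nonempty)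
    (hR : ∀ s ∈ R, ∀ v ∈ A, G.Adj s v → v ∈ T) : Separates G (S \ R ∪ T) (A \ T) where
  nonempty := hAT
  disjoint := by
    have := Finset.disjoint_left.1 h.disjoint
    grind [Finset.disjoint_left]
  exists_notMem := by
    obtain ⟨v, hvA, hvS⟩ := h.exists_notMem
    exact ⟨v, by grind⟩
  encloses := by
    intro u hu v huv
    have := h.encloses u
    have := hR v
    grind [G.adj_comm]

variable [Fintype V]

theorem advance_singleton [DecidableRel G.Adj] (h : Separates G S A) {R : Finset V} {p : V}
    (hA : 1 < #A) (hp : p ∈ A) (hR : ∀ s ∈ R, G.neighborFinset s ∩ A ⊆ {p}) :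
    Separates G (S \ R ∪ {p}) (A \ {p}) := by
  refine h.advance (singleton_subset_iff.2 hp) (sdiff_nonempty.2 fun hsub => ?_)
    fun s hs v hv hsv => hR s hs (by simp [hv, hsv])
  exact hA.not_ge ((card_le_card hsub).trans_eq (card_singleton p))

theorem compl (h : Separates G S A) : Separates G S (A ∪ S)ᶜ where
  nonempty := by simpa [Finset.Nonempty] using h.exists_notMem
  disjoint := by simp +contextual [Finset.disjoint_left]
  exists_notMem := by
    obtain ⟨a, ha⟩ := h.nonempty
    exact ⟨a, by simp [ha], Finset.disjoint_left.1 h.disjoint ha⟩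
  encloses := by
    intro u hu v huv
    have := h.encloses v
    simp only [mem_compl, mem_union] at hu ⊢
    grind [G.adj_comm]

theorem card_neighborFinset_inter_add [DecidableRel G.Adj] (h : Separates G S A) (s : V) :
    #(G.neighborFinset s ∩ A) + #(G.neighborFinset s ∩ S) + #(G.neighborFinset s ∩ (A ∪ S)ᶜ) =
      G.degree s := by
  have hdisj : Disjoint (G.neighborFinset s ∩ A) (G.neighborFinset s ∩ S) :=
    h.disjoint.mono inter_subset_right inter_subset_right
  rw [← card_union_of_disjoint hdisj, ← inter_union_distrib_left, ← sdiff_eq_inter_compl,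
    card_inter_add_card_sdiff, card_neighborFinset_eq_degree]

end Separates

theorem exists_separates_of_isCutset [Finite V] {S : Finset V} (h : G.IsCutset S) :
    ∃ A, Separates G S A := by
  classical
  have := Fintype.ofFinite V
  simp only [IsCutset, Preconnected, not_forall] at h
  obtain ⟨u, v, huv⟩ := h
  refine ⟨({w | ∃ hw : w ∉ S, (G.induce (S : Set V)ᶜ).Reachable u ⟨w, hw⟩} : Finset V), ?_, ?_,
    ?_, ?_⟩
  · exact ⟨u, (mem_filter_univ _).2 ⟨u.2, .refl u⟩⟩
  · simp +contextual [Finset.disjoint_left]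
  · exact ⟨v, by simpa using fun _ => huv, v.2⟩
  · intro w hw z hwz
    obtain ⟨hwS, hr⟩ := (mem_filter_univ w).1 hw
    by_cases hz : z ∈ S
    · exact Or.inr hz
    · have hadj : (G.induce (S : Set V)ᶜ).Adj ⟨w, hwS⟩ ⟨z, hz⟩ := hwz
      exact Or.inl ((mem_filter_univ z).2 ⟨hz, hr.trans hadj.reachable⟩)

theorem isMinimalCutset_of_forall_card_le [Finite V] {S A : Finset V} (h : Separates G S A)
    (hmin : ∀ T B, Separates G T B → #S ≤ #T) : G.IsMinimalCutset S := by
  refine ⟨h.isCutset, fun T hT hTS => ?_⟩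
  obtain ⟨B, hB⟩ := exists_separates_of_isCutset hT
  exact (eq_of_subset_of_card_le hTS (hmin T B hB)).ge

theorem one_le_avgDegreeOn_iff [DecidableRel G.Adj] {S : Finset V} (hS : S.Nonempty) :
    1 ≤ G.avgDegreeOn S ↔ #S ≤ 2 * #(G.induce (S : Set V)).edgeFinset := by
  have hpos : (0 : ℚ) < #S := by simpa using hS.card_pos
  have hcard : Fintype.card (S : Set V) = #S := Fintype.card_coe S
  simp only [avgDegreeOn, avgDegree]
  rw [hcard, one_le_div hpos, ← Nat.cast_sum, Nat.cast_le, sum_degrees_eq_twice_card_edges]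

theorem exists_adj_of_card_edgeFinset_pos [DecidableRel G.Adj] {S : Finset V}
    (h : 0 < #(G.induce (S : Set V)).edgeFinset) : ∃ u ∈ S, ∃ v ∈ S, G.Adj u v := by
  obtain ⟨e, he⟩ := card_pos.1 h
  induction e with | _ u v
  exact ⟨u, u.2, v, v.2, by simpa using he⟩

theorem exists_adj_ne_of_one_lt_card_edgeFinset [DecidableRel G.Adj] {S : Finset V}
    (h : 1 < #(G.induce (S : Set V)).edgeFinset) (e : Sym2 V) :
    ∃ u ∈ S, ∃ v ∈ S, G.Adj u v ∧ s(u, v) ≠ e := by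
  rw [← card_map ⟨_, Sym2.map.injective Subtype.val_injective⟩] at h
  obtain ⟨e', he', hne⟩ := exists_mem_ne h e
  obtain ⟨f, hf, rfl⟩ := mem_map.1 he'
  induction f with | _ u v
  exact ⟨u, u.2, v, v.2, by simpa using hf, hne⟩

theorem degree_induce_coe [Fintype V] [DecidableEq V] [DecidableRel G.Adj] {S : Finset V}
    (v : (S : Set V)) : (G.induce (S : Set V)).degree v = #(G.neighborFinset v ∩ S) := by
  have h := congrArg card (G.map_neighborFinset_induce v)
  rw [card_map, card_neighborFinset_eq_degree] at h
  convert h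
  ext
  simp

/-- Every minimal cutset of at most four vertices induces a subgraph of average degree at
least one: the graphs for which the second alternative of the dichotomy fails. -/
def HasDenseCuts (G : SimpleGraph V) [DecidableRel G.Adj] : Prop :=
  ∀ S : Finset V, G.IsMinimalCutset S → #S ≤ 4 → 1 ≤ G.avgDegreeOn S

theorem card_le_two_mul_card_edgeFinset [Finite V] [DecidableRel G.Adj] {S A : Finset V}
    (h : Separates G S A) (hmin : ∀ T B, Separates G T B → #S ≤ #T) (hconn : G.Preconnected)
    (hdense : HasDenseCuts G) (hS : #S ≤ 4) : #S ≤ 2 * #(G.induce (S : Set V)).edgeFinset :=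
  (one_le_avgDegreeOn_iff (h.left_nonempty hconn)).1
    (hdense S (isMinimalCutset_of_forall_card_le h hmin) hS)

theorem adj_of_separates_pair [Finite V] [DecidableEq V] [DecidableRel G.Adj] {A : Finset V}
    {a b : V} (h : Separates G {a, b} A) (hmin : ∀ T B, Separates G T B → #{a, b} ≤ #T)
    (hconn : G.Preconnected) (hdense : HasDenseCuts G) (hab : a ≠ b) : G.Adj a b := by
  have hcard : #{a, b} = 2 := card_pair hab
  have hedge := card_le_two_mul_card_edgeFinset h hmin hconn hdense (by omega)
  obtain ⟨u, hu, v, hv, huv⟩ := exists_adj_of_card_edgeFinset_pos (G := G) (S := {a, b}) (by omega)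
  grind [G.adj_comm, huv.ne]

/-- An atom in the sense of connectivity theory: a separation `(S, A)` with as few vertices in
the separator `S` as possible and, subject to that, as few vertices in `A` as possible. -/
structure IsSeparationAtom (G : SimpleGraph V) (S A : Finset V) : Prop
    extends Separates G S A where
  card_le : ∀ T B, Separates G T B → #S ≤ #T
  card_le_of_card_le : ∀ T B, Separates G T B → #T ≤ #S → #A ≤ #B

theorem exists_isSeparationAtom {S A : Finset V} (h : Separates G S A) :
    ∃ T B, IsSeparationAtom G T B := by
  obtain ⟨⟨T, B⟩, hTB, hmin⟩ := exists_minimalFor_of_wellFoundedLT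
    (fun P : Finset V × Finset V => Separates G P.1 P.2) (fun P => toLex (#P.1, #P.2))
    ⟨(S, A), h⟩
  have hle (T' B') (h' : Separates G T' B') :
      #T ≤ #T' ∧ (#T' ≤ #T → #B ≤ #B') := by
    have := not_lt.1 fun hlt => (hmin (j := (T', B')) h' hlt.le).not_gt hlt
    simp only [Prod.Lex.toLex_le_toLex] at this
    omega
  exact ⟨T, B, hTB, fun T' B' h' => (hle T' B' h').1, fun T' B' h' => (hle T' B' h').2⟩

namespace IsSeparationAtom

variable [Fintype V] [DecidableEq V] [DecidableRel G.Adj] {S A : Finset V} {d : ℕ}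

theorem two_le_card_neighborFinset_inter (h : IsSeparationAtom G S A)
    (hG : G.IsRegularOfDegree d) (hd : #S < d) {s : V} (hs : s ∈ S) :
    2 ≤ #(G.neighborFinset s ∩ A) := by
  by_contra! hlt
  have hA := h.lt_card_add_card hG
  set T := G.neighborFinset s ∩ A
  have hTA : T ⊆ A := inter_subset_right
  have hAT : #(A \ T) + #T = #A := card_sdiff_add_card_eq_card hTA
  have hsep : Separates G (S \ {s} ∪ T) (A \ T) :=
    h.advance hTA (card_pos.1 (by omega)) (by simp +contextual [T])
  have hcard : #(S \ {s} ∪ T) ≤ #S - 1 + #T := by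
    simpa [card_sdiff_of_subset, hs] using card_union_le (S \ {s}) T
  have hpos : 0 < #S := card_pos.2 ⟨s, hs⟩
  have := h.card_le _ _ hsep
  have := h.card_le_of_card_le _ _ hsep (by omega)
  omega

theorem one_le_card_neighborFinset_inter_compl (h : IsSeparationAtom G S A) {s : V}
    (hs : s ∈ S) : 1 ≤ #(G.neighborFinset s ∩ (A ∪ S)ᶜ) := by
  by_contra! hlt
  have hempty : G.neighborFinset s ∩ (A ∪ S)ᶜ = ∅ := card_eq_zero.1 (by omega)
  have hsep := h.compl.advance (R := {s}) (T := ∅) (empty_subset _)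
    (by simpa using h.compl.nonempty) fun t ht v hv hadj => by
      rw [← hempty, mem_inter, mem_neighborFinset]
      exact ⟨mem_singleton.1 ht ▸ hadj, hv⟩
  have hlt : #(S \ {s} ∪ ∅) < #S := card_lt_card (by grind)
  exact hlt.not_ge (h.card_le _ _ hsep)

theorem three_add_card_neighborFinset_inter_le (h : IsSeparationAtom G S A)
    (hG : G.IsRegularOfDegree d) (hd : #S < d) {s : V} (hs : s ∈ S) :
    3 + #(G.neighborFinset s ∩ S) ≤ d := by
  have := h.two_le_card_neighborFinset_inter hG hd hs
  have := h.one_le_card_neighborFinset_inter_compl hs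
  have := h.card_neighborFinset_inter_add s
  have := hG.degree_eq s
  omega

omit [DecidableEq V] in
theorem card_eq_two (h : IsSeparationAtom G S A) (hG : G.IsRegularOfDegree 4)
    (hconn : G.Preconnected) (hdense : HasDenseCuts G) (hS : #S ≤ 3) : #S = 2 := by
  classical
  have hlower := card_le_two_mul_card_edgeFinset h.toSeparates h.card_le hconn hdense (by omega)
  have hupper : 2 * #(G.induce (S : Set V)).edgeFinset ≤ #S := by
    rw [← sum_degrees_eq_twice_card_edges, ← Fintype.card_coe S, ← card_univ, card_eq_sum_ones]
    refine sum_le_sum fun s _ => ?_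
    rw [degree_induce_coe]
    have := h.three_add_card_neighborFinset_inter_le hG (by omega) s.2
    omega
  have := (h.left_nonempty hconn).card_pos
  omega

theorem exists_neighborFinset_inter_compl_eq_singleton {a b : V} (h : IsSeparationAtom G {a, b} A)
    (hG : G.IsRegularOfDegree 4) (hab : G.Adj a b) :
    ∃ p, G.neighborFinset a ∩ (A ∪ {a, b})ᶜ = {p} := by
  rw [← card_eq_one]
  have := h.two_le_card_neighborFinset_inter hG (by have := card_le_two (a := a) (b := b); omega)
    (mem_insert_self a {b})
  have := h.one_le_card_neighborFinset_inter_compl (mem_insert_self a {b})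
  have : 1 ≤ #(G.neighborFinset a ∩ {a, b}) := card_pos.2 ⟨b, by simpa using hab⟩
  have := h.card_neighborFinset_inter_add a
  have := hG.degree_eq a
  omega

/-- The two vertices of the separator have the same unique neighbor `p` on the far side, so that
`p` alone is a separator. -/
theorem not_pair {a b : V} (hG : G.IsRegularOfDegree 4) (hconn : G.Preconnected)
    (hdense : HasDenseCuts G) (hab : a ≠ b) : ¬ IsSeparationAtom G {a, b} A := by
  intro h
  have hcard : #{a, b} = 2 := card_pair hab
  have hadj : G.Adj a b :=
    adj_of_separates_pair h.toSeparates h.card_le hconn hdense hab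
  obtain ⟨p, hp⟩ := h.exists_neighborFinset_inter_compl_eq_singleton hG hadj
  obtain ⟨q, hq⟩ := IsSeparationAtom.exists_neighborFinset_inter_compl_eq_singleton
    (pair_comm a b ▸ h) hG hadj.symm
  rw [pair_comm b a] at hq
  have hB := h.compl
  generalize (A ∪ {a, b})ᶜ = B at hp hq hB
  have hB1 : 1 < #B := by have := hB.lt_card_add_card hG; omega
  have hpB : p ∈ B := (mem_inter.1 (hp.ge (mem_singleton_self p))).2
  have hbp : G.Adj b p := by
    have hsep : Separates G {b, p} (B \ {p}) := by
      convert hB.advance_singleton (R := {a}) hB1 hpB (by simp [hp]) using 1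
      grind
    refine adj_of_separates_pair hsep (fun T C hTC => ?_) hconn hdense ?_
    · exact card_le_two.trans (hcard ▸ h.card_le T C hTC)
    · rintro rfl
      exact Finset.disjoint_left.1 hB.disjoint hpB (by simp)
  obtain rfl : p = q := by simpa [hpB, hbp] using congrArg (p ∈ ·) hq
  have hsep : Separates G {p} (B \ {p}) := by
    convert hB.advance_singleton (R := {a, b}) hB1 hpB (by simp [hp, hq]) using 1
    grind
  have := h.card_le _ _ hsep
  rw [card_singleton] at this
  omega

end IsSeparationAtom

theorem not_separates_of_card_le_three [Fintype V] [DecidableRel G.Adj]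
    (hG : G.IsRegularOfDegree 4) (hconn : G.Preconnected) (hdense : HasDenseCuts G)
    {S A : Finset V} (hS : #S ≤ 3) : ¬ Separates G S A := by
  classical
  intro h
  obtain ⟨T, B, hTB⟩ := exists_isSeparationAtom h
  obtain ⟨a, b, hab, rfl⟩ := card_eq_two.1
    (hTB.card_eq_two hG hconn hdense ((hTB.card_le S A h).trans hS))
  exact IsSeparationAtom.not_pair hG hconn hdense hab hTB

end SmallSeparators

section WellLinked

open Finset SimpleGraph

variable {V : Type*} {G : SimpleGraph V} {x a b c d : V}

/-- The vertices `p`, `q`, `r`, `s` are the neighbors of `v`, each listed once. -/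
structure HasNeighbors (G : SimpleGraph V) (v p q r s : V) : Prop where
  ne_center : v ≠ p ∧ v ≠ q ∧ v ≠ r ∧ v ≠ s
  ne : p ≠ q ∧ p ≠ r ∧ p ≠ s ∧ q ≠ r ∧ q ≠ s ∧ r ≠ s
  adj_iff : ∀ w, G.Adj v w ↔ w = p ∨ w = q ∨ w = r ∨ w = s

namespace HasNeighbors

theorem swap (h : HasNeighbors G x a b c d) : HasNeighbors G x b a c d := by
  grind [HasNeighbors]

theorem rotate (h : HasNeighbors G x a b c d) : HasNeighbors G x b c d a := by
  grind [HasNeighbors]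

theorem adj_center (h : HasNeighbors G x a b c d) :
    G.Adj a x ∧ G.Adj b x ∧ G.Adj c x ∧ G.Adj d x := by
  simp [G.adj_comm, h.adj_iff]

theorem nonempty_iso_twoK2 (h : HasNeighbors G x a b c d) (hab : G.Adj a b) (hcd : G.Adj c d)
    (hnot : ¬ G.Adj a c ∧ ¬ G.Adj a d ∧ ¬ G.Adj b c ∧ ¬ G.Adj b d) :
    Nonempty (G.induce (G.neighborSet x) ≃g twoK2) := by
  have hmem (v : V) : v ∈ G.neighborSet x ↔ v = a ∨ v = b ∨ v = c ∨ v = d := h.adj_iff v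
  let φ : Fin 2 ⊕ Fin 2 → G.neighborSet x :=
    Sum.elim ![⟨a, by simp [hmem]⟩, ⟨b, by simp [hmem]⟩] ![⟨c, by simp [hmem]⟩, ⟨d, by simp [hmem]⟩]
  have hφ : Function.Bijective φ := by
    constructor
    · rintro (i | i) (j | j) hij <;> fin_cases i <;> fin_cases j <;>
        simp [φ] at hij ⊢ <;> grind [h.ne]
    · rintro ⟨v, hv⟩
      rcases (hmem v).1 hv with rfl | rfl | rfl | rfl
      exacts [⟨Sum.inl 0, rfl⟩, ⟨Sum.inl 1, rfl⟩, ⟨Sum.inr 0, rfl⟩, ⟨Sum.inr 1, rfl⟩]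
  refine ⟨RelIso.symm ⟨Equiv.ofBijective φ hφ, ?_⟩⟩
  rintro (i | i) (j | j) <;> fin_cases i <;> fin_cases j <;>
    simp [φ, twoK2, hab, hcd, hnot, G.adj_comm b a, G.adj_comm c, G.adj_comm d]

end HasNeighbors

/-- The neighborhood of `x` induces the path `a b c d`. -/
structure IsPathAt (G : SimpleGraph V) (a b x c d : V) : Prop where
  hasNeighbors : HasNeighbors G x a b c d
  adj : G.Adj a b ∧ G.Adj b c ∧ G.Adj c d
  not_adj : ¬ G.Adj a c ∧ ¬ G.Adj b d ∧ ¬ G.Adj a d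

/-- A `4`-regular graph that no small set of vertices separates in a sparse way: no set of at most
three vertices encloses a set of at most five, and a set of at most four vertices enclosing a set
of at most four spans two edges, hence an edge with an end outside any given pair `p`, `q`. -/
structure WellLinked (G : SimpleGraph V) [G.LocallyFinite] : Prop where
  regular : G.IsRegularOfDegree 4
  false_of_encloses {W S : Finset V} (h : Encloses G S W) (hne : W.Nonempty := by simp)
    (hW : #W ≤ 5 := by grind [card_insert_le]) (hS : #S ≤ 3 := by grind [card_insert_le]) : False
  exists_adj_of_encloses {W S : Finset V} (p q : V) (h : Encloses G S W)
    (hne : W.Nonempty := by simp) (hW : #W ≤ 4 := by grind [card_insert_le])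
    (hS : #S ≤ 4 := by grind [card_insert_le]) :
    ∃ u ∈ S, ∃ v ∈ S, G.Adj u v ∧ u ≠ p ∧ u ≠ q

namespace WellLinked

variable [G.LocallyFinite]

theorem exists_adj_notMem (H : WellLinked G) (x : V) {T : Finset V} (hT : #T < 4) :
    ∃ v, G.Adj x v ∧ v ∉ T := by
  obtain ⟨v, hv, hvT⟩ := exists_mem_notMem_of_card_lt_card (s := T) (t := G.neighborFinset x)
    (by rwa [card_neighborFinset_eq_degree, H.regular.degree_eq])
  exact ⟨v, (mem_neighborFinset ..).1 hv, hvT⟩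

theorem exists_hasNeighbors (H : WellLinked G) (ha : G.Adj x a) (hb : G.Adj x b)
    (hc : G.Adj x c) (hne : a ≠ b ∧ a ≠ c ∧ b ≠ c) : ∃ d, HasNeighbors G x a b c d := by
  classical
  obtain ⟨d, hd, hnot⟩ := H.exists_adj_notMem x (T := {a, b, c})
    (card_le_three.trans_lt (by norm_num))
  simp only [mem_insert, mem_singleton] at hnot
  have hcard : #{a, b, c, d} = 4 := card_eq_four.2 ⟨a, b, c, d, by grind only⟩
  have hnbhd : {a, b, c, d} = G.neighborFinset x := by
    refine eq_of_subset_of_card_le (by simp [insert_subset_iff, ha, hb, hc, hd]) ?_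
    rw [card_neighborFinset_eq_degree, H.regular.degree_eq, hcard]
  exact ⟨d, ⟨ha.ne, hb.ne, hc.ne, hd.ne⟩, by grind only,
    fun w => by simp [← mem_neighborFinset, ← hnbhd]⟩

theorem exists_hasNeighbors_pair (H : WellLinked G) (ha : G.Adj x a) (hb : G.Adj x b)
    (hne : a ≠ b) : ∃ c d, HasNeighbors G x a b c d := by
  classical
  obtain ⟨c, hc, hnot⟩ := H.exists_adj_notMem x (T := {a, b}) (card_le_two.trans_lt (by norm_num))
  exact ⟨c, H.exists_hasNeighbors ha hb hc (by grind)⟩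

theorem exists_adj_adj (H : WellLinked G) (hx : HasNeighbors G x a b c d) :
    ∃ v, G.Adj x v ∧ (G.Adj a v ∨ G.Adj b v) := by
  classical
  obtain ⟨u, hu, v, hv, huv, huc, hud⟩ := H.exists_adj_of_encloses (W := {x}) (S := {a, b, c, d})
    c d (by grind [Encloses, HasNeighbors])
  exact ⟨v, (hx.adj_iff v).2 (by simpa using hv), by grind⟩

theorem not_dominated (H : WellLinked G) (hx : HasNeighbors G x a b c d) :
    ¬ (G.Adj a b ∧ G.Adj a c ∧ G.Adj a d) := by
  classical
  rintro ⟨hb, hc, hd⟩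
  obtain ⟨y, ha⟩ := H.exists_hasNeighbors hx.adj_center.1 hb hc (by grind [hx.ne_center, hx.ne])
  refine H.false_of_encloses (W := {x, a}) (S := {b, c, d}) ?_
  grind [Encloses, HasNeighbors]

theorem not_fourCycle (H : WellLinked G) (hx : HasNeighbors G x a b c d) :
    ¬ (G.Adj a b ∧ G.Adj b c ∧ G.Adj c d ∧ G.Adj d a) := by
  classical
  rintro ⟨hab, hbc, hcd, hda⟩
  have hac := H.not_dominated hx
  have hbd := H.not_dominated hx.swap
  obtain ⟨hax, hbx, hcx, hdx⟩ := hx.adj_center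
  obtain ⟨a', ha⟩ := H.exists_hasNeighbors hax hab hda.symm
    (by grind [hx.ne_center, hx.ne])
  obtain ⟨b', hb⟩ := H.exists_hasNeighbors hbx hab.symm hbc
    (by grind [hx.ne_center, hx.ne])
  obtain ⟨c', hc⟩ := H.exists_hasNeighbors hcx hbc.symm hcd
    (by grind [hx.ne_center, hx.ne])
  obtain ⟨d', hd⟩ := H.exists_hasNeighbors hdx hcd.symm hda
    (by grind [hx.ne_center, hx.ne])
  have hab' : a' ≠ b' := by
    rintro rfl
    exact H.false_of_encloses (W := {x, a, b}) (S := {a', c, d}) (by grind [Encloses, HasNeighbors])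
  have hbc' : b' ≠ c' := by
    rintro rfl
    exact H.false_of_encloses (W := {x, b, c}) (S := {b', a, d}) (by grind [Encloses, HasNeighbors])
  have hcd' : c' ≠ d' := by
    rintro rfl
    exact H.false_of_encloses (W := {x, c, d}) (S := {c', a, b}) (by grind [Encloses, HasNeighbors])
  have hda' : d' ≠ a' := by
    rintro rfl
    exact H.false_of_encloses (W := {x, d, a}) (S := {d', b, c}) (by grind [Encloses, HasNeighbors])
  obtain ⟨u, hu, v, hv, huv, hu'⟩ := H.exists_adj_of_encloses (W := {x, a, c})
    (S := {a', b, c', d}) a' c' (by grind [Encloses, HasNeighbors])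
  grind [G.adj_comm, HasNeighbors, huv.ne]

theorem not_triangle (H : WellLinked G) (hx : HasNeighbors G x a b c d) :
    ¬ (G.Adj a b ∧ G.Adj b c ∧ G.Adj a c) := by
  classical
  rintro ⟨hab, hbc, hac⟩
  have had := H.not_dominated hx
  have hbd := H.not_dominated hx.swap
  have hcd := H.not_dominated hx.rotate.rotate
  obtain ⟨hax, hbx, hcx, hdx⟩ := hx.adj_center
  obtain ⟨a', ha⟩ := H.exists_hasNeighbors hax hab hac (by grind [hx.ne_center, hx.ne])
  obtain ⟨b', hb⟩ := H.exists_hasNeighbors hbx hab.symm hbc (by grind [hx.ne_center, hx.ne])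
  obtain ⟨c', hc⟩ := H.exists_hasNeighbors hcx hac.symm hbc.symm
    (by grind [hx.ne_center, hx.ne])
  have hab' : a' ≠ b' := by
    rintro rfl
    exact H.false_of_encloses (W := {x, a, b}) (S := {a', c, d}) (by grind [Encloses, HasNeighbors])
  have hac' : a' ≠ c' := by
    rintro rfl
    exact H.false_of_encloses (W := {x, a, c}) (S := {a', b, d}) (by grind [Encloses, HasNeighbors])
  have hbc' : b' ≠ c' := by
    rintro rfl
    exact H.false_of_encloses (W := {x, b, c}) (S := {b', a, d}) (by grind [Encloses, HasNeighbors])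
  have hda' : G.Adj d a' := by
    obtain ⟨u, hu, v, hv, huv, hu'⟩ := H.exists_adj_of_encloses (W := {x, a})
      (S := {a', b, c, d}) b c (by grind [Encloses, HasNeighbors])
    grind [G.adj_comm, HasNeighbors, huv.ne]
  have hdb' : G.Adj d b' := by
    obtain ⟨u, hu, v, hv, huv, hu'⟩ := H.exists_adj_of_encloses (W := {x, b})
      (S := {b', a, c, d}) a c (by grind [Encloses, HasNeighbors])
    grind [G.adj_comm, HasNeighbors, huv.ne]
  have hdc' : G.Adj d c' := by
    obtain ⟨u, hu, v, hv, huv, hu'⟩ := H.exists_adj_of_encloses (W := {x, c})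
      (S := {c', a, b, d}) a b (by grind [Encloses, HasNeighbors])
    grind [G.adj_comm, HasNeighbors, huv.ne]
  obtain ⟨d', hd⟩ := H.exists_hasNeighbors hda' hdb' hdc' ⟨hab', hac', hbc'⟩
  exact H.false_of_encloses (W := {x, a, b, c, d}) (S := {a', b', c'})
    (by grind [Encloses, HasNeighbors])

theorem ne_of_isPathAt {b' c' : V} (H : WellLinked G) (h : IsPathAt G a b x c d)
    (hb : HasNeighbors G b x a c b') (hc : HasNeighbors G c x b d c') : b' ≠ c' := by
  classical
  rintro rfl
  exact H.false_of_encloses (W := {x, b, c}) (S := {a, b', d})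
    (by grind [Encloses, HasNeighbors, h.hasNeighbors])

theorem exists_adj_of_common_neighbor {y z : V} (H : WellLinked G)
    (hb : HasNeighbors G b x a c y) (hd : HasNeighbors G d x c y z) (hbd : ¬ G.Adj b d)
    (hza : z ≠ a) : ∃ v, (v = x ∨ v = a ∨ v = c) ∧ (G.Adj v y ∨ G.Adj v z) := by
  classical
  by_contra! hno
  obtain ⟨-, -, -, hyb⟩ := hb.adj_center
  obtain ⟨-, -, hyd, hzd⟩ := hd.adj_center
  have hyapart : ¬ G.Adj y x ∧ ¬ G.Adj y a ∧ ¬ G.Adj y c := by grind [G.adj_comm]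
  have hbz : ¬ G.Adj b z := by grind [HasNeighbors]
  have hedge (v) (hv : G.Adj y v) : ¬ G.Adj b v := by grind [G.adj_comm, hb.adj_iff, hv.ne]
  have hyz : G.Adj y z := by
    obtain ⟨p, q, hy⟩ := H.exists_hasNeighbors_pair hyb hyd (by grind [HasNeighbors, G.adj_comm])
    obtain ⟨v, hv, hbv⟩ := H.exists_adj_adj hy
    grind [G.adj_comm, hd.adj_iff, hv.ne]
  obtain ⟨p, hy⟩ := H.exists_hasNeighbors hyb hyd hyz (by grind [G.adj_comm, HasNeighbors])
  have hzp : G.Adj z p := by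
    obtain ⟨v, hv, hpv⟩ := H.exists_adj_adj hy.rotate.rotate.rotate
    grind [G.adj_comm, HasNeighbors, G.ne_of_adj]
  obtain ⟨q, hz⟩ := H.exists_hasNeighbors hzd hyz.symm hzp (by grind [HasNeighbors])
  obtain ⟨u, hu, v, hv, huv, hu'⟩ := H.exists_adj_of_encloses (W := {y, z}) (S := {b, d, q, p})
    q p (by grind [Encloses, HasNeighbors])
  grind [G.adj_comm, HasNeighbors, hz.adj_center]

theorem not_crossed {b' c' : V} (H : WellLinked G) (h : IsPathAt G a b x c d)
    (hb : HasNeighbors G b x a c b') (hc : HasNeighbors G c x b d c') :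
    ¬ (G.Adj b' d ∧ G.Adj c' a) := by
  classical
  rintro ⟨hbd', hca'⟩
  have hne := H.ne_of_isPathAt h hb hc
  obtain ⟨hx, ⟨hab, -, hcd⟩, -, hbd, had⟩ := h
  obtain ⟨hax, -, -, hdx⟩ := hx.adj_center
  obtain ⟨a', ha⟩ := H.exists_hasNeighbors hax hab hca'.symm
    (by grind [hx.ne_center, hx.ne, hc.ne])
  obtain ⟨d', hd⟩ := H.exists_hasNeighbors hdx hcd.symm hbd'.symm
    (by grind [hx.ne_center, hx.ne, hb.ne])
  have hne' : a' ≠ d' := by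
    rintro rfl
    exact H.false_of_encloses (W := {x, a, b, c, d}) (S := {a', b', c'})
      (by grind [Encloses, HasNeighbors])
  have hab' : a' ≠ b' := by
    rintro rfl
    exact H.false_of_encloses (W := {x, a, b, c}) (S := {a', c', d})
      (by grind [Encloses, HasNeighbors])
  have hdc' : d' ≠ c' := by
    rintro rfl
    exact H.false_of_encloses (W := {x, b, c, d}) (S := {b', d', a})
      (by grind [Encloses, HasNeighbors])
  obtain ⟨v, hv, hv'⟩ := H.exists_adj_of_common_neighbor hb hd hbd
    (by grind [HasNeighbors, G.adj_comm])
  grind [G.adj_comm, HasNeighbors]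

theorem adj_of_isPathAt {b' c' : V} (H : WellLinked G) (h : IsPathAt G a b x c d)
    (hb : HasNeighbors G b x a c b') (hc : HasNeighbors G c x b d c') :
    G.Adj b' a ∧ G.Adj c' d := by
  classical
  have hne := H.ne_of_isPathAt h hb hc
  have hcross := H.not_crossed h hb hc
  obtain ⟨hx, ⟨hab, hbc, hcd⟩, hac, hbd, had⟩ := h
  obtain ⟨hax, hbx, hcx, hdx⟩ := hx.adj_center
  have hb' : G.Adj b' a ∨ G.Adj b' d := by
    obtain ⟨u, hu, v, hv, huv, hu'⟩ := H.exists_adj_of_encloses (W := {x, b}) (S := {a, b', c, d})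
      c d (by grind [Encloses, HasNeighbors])
    grind [G.adj_comm, HasNeighbors, huv.ne]
  have hc' : G.Adj c' a ∨ G.Adj c' d := by
    obtain ⟨u, hu, v, hv, huv, hu'⟩ := H.exists_adj_of_encloses (W := {x, c}) (S := {a, b, c', d})
      a b (by grind [Encloses, HasNeighbors])
    grind [G.adj_comm, HasNeighbors, huv.ne]
  have hnot_left : ¬ (G.Adj b' a ∧ G.Adj c' a) := by
    rintro ⟨hba, hca⟩
    obtain ⟨y, ha⟩ := H.exists_hasNeighbors hax hab hba.symm (by grind [HasNeighbors])
    exact H.false_of_encloses (W := {x, a, b, c}) (S := {b', c', d})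
      (by grind [Encloses, HasNeighbors, G.adj_comm])
  have hnot_right : ¬ (G.Adj b' d ∧ G.Adj c' d) := by
    rintro ⟨hbd, -⟩
    obtain ⟨y, hd⟩ := H.exists_hasNeighbors hdx hcd.symm hbd.symm (by grind [HasNeighbors])
    exact H.false_of_encloses (W := {x, d, b, c}) (S := {b', c', a})
      (by grind [Encloses, HasNeighbors, G.adj_comm])
  tauto

theorem exists_isPathAt_next (H : WellLinked G) (h : IsPathAt G a b x c d) :
    ∃ e, IsPathAt G b x c d e := by
  have ⟨hx, ⟨hab, hbc, hcd⟩, hac, hbd, had⟩ := h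
  obtain ⟨-, hbx, hcx, hdx⟩ := hx.adj_center
  obtain ⟨b', hb⟩ := H.exists_hasNeighbors hbx hab.symm hbc (by grind [HasNeighbors])
  obtain ⟨e, hc⟩ := H.exists_hasNeighbors hcx hbc.symm hcd (by grind [HasNeighbors])
  have hne := H.ne_of_isPathAt h hb hc
  obtain ⟨-, hed⟩ := H.adj_of_isPathAt h hb hc
  exact ⟨e, by grind [HasNeighbors], ⟨hbx, hdx.symm, hed.symm⟩, by grind [G.adj_comm, HasNeighbors]⟩

theorem not_path_add_isolated (H : WellLinked G) (hx : HasNeighbors G x a b c d)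
    (hab : G.Adj a b) (hbc : G.Adj b c) (hac : ¬ G.Adj a c) :
    ¬ (¬ G.Adj a d ∧ ¬ G.Adj b d ∧ ¬ G.Adj c d) := by
  classical
  rintro ⟨had, hbd, hcd⟩
  obtain ⟨hax, hbx, hcx, hdx⟩ := hx.adj_center
  obtain ⟨b', hb⟩ := H.exists_hasNeighbors hbx hab.symm hbc (by grind [HasNeighbors])
  have hxb' : ¬ G.Adj x b' := by grind [HasNeighbors]
  have hnot_both : ¬ (G.Adj b' a ∧ G.Adj b' c) := fun ⟨hba, hbc'⟩ =>
    H.not_fourCycle (a := x) (b := a) (c := b') (d := c) (x := b) (by grind [HasNeighbors])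
      ⟨hax.symm, hba.symm, hbc', hcx⟩
  have hba : ¬ G.Adj b' a := by
    intro hba
    have hpath : IsPathAt G b' a b x c := by grind [IsPathAt, HasNeighbors, G.adj_comm]
    obtain ⟨a', ha⟩ := H.exists_hasNeighbors hab hba.symm hax (by grind [HasNeighbors])
    exact hcd (H.adj_of_isPathAt hpath ha (by grind [HasNeighbors])).2.symm
  have hbc' : ¬ G.Adj b' c := by
    intro hbc'
    have hpath : IsPathAt G b' c b x a := by grind [IsPathAt, HasNeighbors, G.adj_comm]
    obtain ⟨c', hc⟩ := H.exists_hasNeighbors hbc.symm hbc'.symm hcx (by grind [HasNeighbors])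
    exact had (H.adj_of_isPathAt hpath hc (by grind [HasNeighbors])).2.symm
  obtain ⟨u, hu, v, hv, huv, hu'⟩ := H.exists_adj_of_encloses (W := {x, b}) (S := {a, b', c, d})
    b' d (by grind [Encloses, HasNeighbors])
  grind [G.adj_comm, huv.ne]

theorem exists_isPathAt_of_adj_adj (H : WellLinked G) (hx : HasNeighbors G x a b c d)
    (hab : G.Adj a b) (hbc : G.Adj b c) : ∃ p q r s, IsPathAt G p q x r s := by
  have hbd := H.not_dominated hx.swap
  have hac := H.not_triangle hx
  have hcycle := H.not_fourCycle hx
  have hpath := H.not_path_add_isolated hx hab hbc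
  by_cases had : G.Adj a d
  · exact ⟨d, a, b, c, hx.rotate.rotate.rotate, by grind [G.adj_comm], by grind [G.adj_comm]⟩
  · exact ⟨a, b, c, d, hx, by grind [G.adj_comm], by grind [G.adj_comm]⟩

theorem exists_isPathAt (H : WellLinked G)
    (hx : ¬ Nonempty (G.induce (G.neighborSet x) ≃g twoK2)) :
    ∃ a b c d, IsPathAt G a b x c d := by
  classical
  by_contra! hno
  have hmatching (p q r s) (h : HasNeighbors G x p q r s) (hpq : G.Adj p q) : ¬ G.Adj q r := by
    intro hqr
    obtain ⟨a, b, c, d, habcd⟩ := H.exists_isPathAt_of_adj_adj h hpq hqr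
    exact hno a b c d habcd
  obtain ⟨p, hp, q, hq, hpq, -⟩ := H.exists_adj_of_encloses (W := {x}) (S := G.neighborFinset x)
    x x (by simp +contextual [Encloses]) (hS := by simp [H.regular.degree_eq])
  rw [mem_neighborFinset] at hp hq
  obtain ⟨r, s, hN⟩ := H.exists_hasNeighbors_pair hp hq hpq.ne
  have hqr := hmatching _ _ _ _ hN hpq
  have hqs := hmatching p q s r (by grind [HasNeighbors]) hpq
  have hpr := hmatching _ _ _ _ hN.swap hpq.symm
  have hps := hmatching q p s r (by grind [HasNeighbors]) hpq.symm
  have hrs : G.Adj r s := by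
    obtain ⟨v, hv, hrv⟩ := H.exists_adj_adj hN.rotate.rotate
    grind [G.adj_comm, HasNeighbors, G.ne_of_adj]
  exact hx (hN.nonempty_iso_twoK2 hpq hrs ⟨hpr, hps, hqr, hqs⟩)

end WellLinked

theorem Encloses.separates [Fintype V] [DecidableEq V] {W S : Finset V} (h : Encloses G S W)
    (hW : W.Nonempty) (hcard : #W + #S < Fintype.card V) : Separates G (S \ W) W where
  nonempty := hW
  disjoint := disjoint_sdiff
  exists_notMem := by
    have hlt : #(W ∪ S) < #(univ : Finset V) := (card_union_le W S).trans_lt hcard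
    obtain ⟨v, -, hv⟩ := exists_mem_notMem_of_card_lt_card hlt
    exact ⟨v, by grind⟩
  encloses w hw v hwv := by
    have := h w hw v hwv
    grind

theorem wellLinked [Fintype V] [DecidableRel G.Adj] (hcard : 9 ≤ Fintype.card V)
    (hG : G.IsRegularOfDegree 4) (hconn : G.Preconnected) (hdense : HasDenseCuts G) :
    WellLinked G := by
  classical
  have hlarge {S A : Finset V} (h : Separates G S A) : 4 ≤ #S := by
    by_contra! hS
    exact not_separates_of_card_le_three hG hconn hdense (Nat.lt_succ_iff.1 hS) h
  refine ⟨hG, fun {W S} h hne hW hS => ?_, fun {W S} p q h hne hW hS => ?_⟩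
  · have := hlarge (h.separates hne (by omega))
    have := card_le_card (sdiff_subset (s := S) (t := W))
    omega
  · have hsep := h.separates hne (by omega)
    have hS4 := hlarge hsep
    rw [eq_of_subset_of_card_le sdiff_subset (hS.trans hS4)] at hsep hS4
    have hedges := card_le_two_mul_card_edgeFinset hsep (fun T B hTB => hS.trans (hlarge hTB))
      hconn hdense hS
    obtain ⟨u, hu, v, hv, huv, hne⟩ := exists_adj_ne_of_one_lt_card_edgeFinset (G := G) (S := S)
      (by omega) s(p, q)
    rw [Ne, Sym2.eq_iff] at hne
    have := huv.ne
    by_cases hu' : u = p ∨ u = q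
    · exact ⟨v, hv, u, hu, huv.symm, by grind, by grind⟩
    · exact ⟨u, hu, v, hv, huv, by grind, by grind⟩

end WellLinked

section SquareLine

open SimpleGraph

variable {V : Type*} {G : SimpleGraph V} {f : ℤ → V}

theorem IsPathAt.inner_eq_or_swap {x a b c d a' b' c' d' : V} (h : IsPathAt G a b x c d)
    (h' : IsPathAt G a' b' x c' d') : (b' = b ∧ c' = c) ∨ (b' = c ∧ c' = b) := by
  have hmem (w : V) := (h.hasNeighbors.adj_iff w).symm.trans (h'.hasNeighbors.adj_iff w)
  have ha := (hmem a').2 (by simp)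
  have hb := (hmem b').2 (by simp)
  have hc := (hmem c').2 (by simp)
  have hd := (hmem d').2 (by simp)
  have hne := h'.hasNeighbors.ne
  obtain ⟨-, hadj, hnot⟩ := h
  obtain ⟨-, hadj', hnot'⟩ := h'
  clear hmem
  rcases hb with rfl | rfl | rfl | rfl <;> rcases hc with rfl | rfl | rfl | rfl <;>
    grind [G.adj_comm]

theorem IsPathAt.first_eq {x a a' b c d : V} (h : IsPathAt G a b x c d)
    (h' : IsPathAt G a' b x c d) : a = a' := by
  obtain ⟨hab, hac, had, -⟩ := h.hasNeighbors.ne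
  have hmem := (h'.hasNeighbors.adj_iff a).1 ((h.hasNeighbors.adj_iff a).2 (Or.inl rfl))
  simpa only [hab, hac, had, or_false] using hmem

/-- A two-way infinite sequence of vertices locally equal to the square of a path: the two
preceding and the two following terms form, in this order, the path that is induced on the
neighborhood of each term. -/
def IsSquareLine (G : SimpleGraph V) (f : ℤ → V) : Prop :=
  ∀ i, IsPathAt G (f (i - 2)) (f (i - 1)) (f i) (f (i + 1)) (f (i + 2))

/-- Shifting a window of five vertices is injective, hence a permutation of the finitely many
windows, and its integer powers continue a given window in both directions. -/
theorem WellLinked.exists_isSquareLine [Finite V] [G.LocallyFinite]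
    (H : WellLinked G) {a b x c d : V} (h : IsPathAt G a b x c d) : ∃ f, IsSquareLine G f := by
  let T := {w : Fin 5 → V // IsPathAt G (w 0) (w 1) (w 2) (w 3) (w 4)}
  have hnext (w : T) : ∃ w' : T,
      w'.1 0 = w.1 1 ∧ w'.1 1 = w.1 2 ∧ w'.1 2 = w.1 3 ∧ w'.1 3 = w.1 4 := by
    obtain ⟨e, he⟩ := H.exists_isPathAt_next w.2
    exact ⟨⟨![w.1 1, w.1 2, w.1 3, w.1 4, e], he⟩, rfl, rfl, rfl, rfl⟩
  choose next h0 h1 h2 h3 using hnext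
  have hinj : Function.Injective next := by
    intro v w hvw
    have e1 : v.1 1 = w.1 1 := by rw [← h0, ← h0, hvw]
    have e2 : v.1 2 = w.1 2 := by rw [← h1, ← h1, hvw]
    have e3 : v.1 3 = w.1 3 := by rw [← h2, ← h2, hvw]
    have e4 : v.1 4 = w.1 4 := by rw [← h3, ← h3, hvw]
    have hv := v.2
    rw [e1, e2, e3, e4] at hv
    have e0 : v.1 0 = w.1 0 := hv.first_eq w.2
    ext i
    fin_cases i <;> assumption
  let σ : Equiv.Perm T := .ofBijective next (Finite.injective_iff_bijective.1 hinj)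
  let W (i : ℤ) : T := (σ ^ i) ⟨![a, b, x, c, d], h⟩
  have hW (i : ℤ) : W (i + 1) = next (W i) := by
    simp only [W, add_comm i, zpow_add, zpow_one, Equiv.Perm.mul_apply]
    rfl
  have hW' (i : ℤ) : W i = next (W (i - 1)) := by rw [← hW, sub_add_cancel]
  refine ⟨fun i => (W i).1 2, fun i => ?_⟩
  have e0 : (W i).1 0 = (W (i - 2)).1 2 := by
    rw [hW' i, h0, hW' (i - 1), h1, sub_sub, one_add_one_eq_two]
  have e1 : (W i).1 1 = (W (i - 1)).1 2 := by rw [hW' i, h1]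
  have e3 : (W i).1 3 = (W (i + 1)).1 2 := by rw [hW, h2]
  have e4 : (W i).1 4 = (W (i + 2)).1 2 := by
    rw [← one_add_one_eq_two, ← add_assoc, hW, h2, hW, h3]
  simpa only [e0, e1, e3, e4] using (W i).2

theorem cycleGraph_square_adj {n : ℕ} {u v : Fin (n + 2)} :
    (cycleGraph (n + 2)).square.Adj u v ↔
      u ≠ v ∧ (v = u - 2 ∨ v = u - 1 ∨ v = u + 1 ∨ v = u + 2) := by
  have h2 : (2 : Fin (n + 2)) = 1 + 1 := Fin.ext (by simp [Fin.val_add])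
  simp only [square, cycleGraph_adj, h2]
  refine and_congr_right fun _ => ?_
  constructor
  · grind
  · rintro (h | h | h | h)
    · exact Or.inr ⟨u - 1, by simp [h]⟩
    · simp [h]
    · simp [h]
    · exact Or.inr ⟨u + 1, by simp [h]⟩

namespace IsSquareLine

theorem adj_iff (hf : IsSquareLine G f) (i : ℤ) (v : V) :
    G.Adj (f i) v ↔ v = f (i - 2) ∨ v = f (i - 1) ∨ v = f (i + 1) ∨ v = f (i + 2) :=
  (hf i).hasNeighbors.adj_iff v

theorem surjective (hf : IsSquareLine G f) (hG : G.Preconnected) : Function.Surjective f := by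
  refine mem_of_preconnected (s := Set.range f) (u := f 0) hG ⟨0, rfl⟩ ?_
  rintro _ ⟨i, rfl⟩ w hw
  rcases (hf.adj_iff i w).1 hw with rfl | rfl | rfl | rfl <;> exact ⟨_, rfl⟩

theorem eq_shift_of_eq (hf : IsSquareLine G f) {p : ℕ} (hp : 0 < p)
    (hmin : ∀ q : ℕ, 0 < q → q < p → ∀ i, f (i + q) ≠ f i) {i : ℤ} (h : f (i + p) = f i) :
    f (i + 1 + p) = f (i + 1) ∧ f (i - 1 + p) = f (i - 1) := by
  have hpath := hf (i + p)
  rw [h] at hpath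
  rcases (hf i).inner_eq_or_swap hpath with ⟨hb, hc⟩ | ⟨hb, hc⟩
  · exact ⟨by rw [add_right_comm, hc], by rw [sub_add_eq_add_sub, hb]⟩
  · -- Returning in the opposite direction would produce the smaller gap `p - 2`.
    have h1 : p ≠ 1 := by
      rintro rfl
      exact (hf i).hasNeighbors.ne_center.2.2.1 h.symm
    have h2 : p ≠ 2 := by
      rintro rfl
      exact (hf i).hasNeighbors.ne_center.2.2.2 h.symm
    have hgap : f (i + 1 + (p - 2 : ℕ)) = f (i + 1) := by
      rw [← hb]
      congr 1
      omega
    exact (hmin (p - 2) (by omega) (by omega) (i + 1) hgap).elim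

theorem exists_eq_iff_dvd [Finite V] (hf : IsSquareLine G f) :
    ∃ p : ℕ, 0 < p ∧ ∀ i j, f i = f j ↔ (p : ℤ) ∣ i - j := by
  classical
  have hex : ∃ p : ℕ, 0 < p ∧ ∃ i, f (i + p) = f i := by
    obtain ⟨i, j, hij, h⟩ := Finite.exists_ne_map_eq_of_infinite fun n : ℕ => f n
    wlog hlt : i < j generalizing i j
    · exact this j i hij.symm h.symm (by omega)
    · exact ⟨j - i, by omega, i, by rw [h]; congr 1; omega⟩
  obtain ⟨hp, k, hk⟩ := Nat.find_spec hex
  have hmin (q : ℕ) (hq : 0 < q) (hqp : q < Nat.find hex) (i : ℤ) : f (i + q) ≠ f i :=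
    fun h => Nat.find_min hex hqp ⟨hq, i, h⟩
  generalize Nat.find hex = p at hp hk hmin
  have hper : Function.Periodic f p := fun i => by
    induction i using Int.inductionOn' (b := k) with
    | zero => exact hk
    | succ i _ ih => exact (hf.eq_shift_of_eq hp hmin ih).1
    | pred i _ ih => exact (hf.eq_shift_of_eq hp hmin ih).2
  refine ⟨p, hp, fun i j => ⟨fun h => ?_, fun ⟨m, hm⟩ => ?_⟩⟩
  · have hr := Int.emod_nonneg (i - j) (Int.natCast_ne_zero.2 hp.ne')
    have hrp := Int.emod_lt_of_pos (i - j) (Int.natCast_pos.2 hp)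
    have hij : f (j + (i - j) % p) = f j := by
      rw [← h, ← hper.sub_zsmul_eq (x := i) ((i - j) / p), smul_eq_mul, Int.emod_def]
      congr 1
      ring
    by_contra hdvd
    rw [Int.dvd_iff_emod_eq_zero] at hdvd
    lift (i - j) % p to ℕ using hr with r
    exact hmin r (by omega) (by omega) j hij
  · rw [eq_add_of_sub_eq' hm, mul_comm, ← smul_eq_mul, hper.zsmul]

theorem nonempty_iso [Fintype V] (hf : IsSquareLine G f) (hG : G.Preconnected) :
    Nonempty (G ≃g (cycleGraph (Fintype.card V)).square) := by
  obtain ⟨p, hp, hdvd⟩ := hf.exists_eq_iff_dvd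
  obtain ⟨n, rfl⟩ : ∃ n, p = n + 2 := by
    have h1 : p ≠ 1 := by
      rintro rfl
      exact (hf 0).hasNeighbors.ne_center.2.2.1 ((hdvd _ _).2 (by simp))
    exact ⟨p - 2, by omega⟩
  let φ (z : ZMod (n + 2)) : V := f z.val
  have hφ (i : ℤ) : φ i = f i := by
    rw [hdvd, ← ZMod.intCast_eq_intCast_iff_dvd_sub]
    simp
  have hinj : Function.Injective φ := by
    intro z w h
    rw [hdvd, ← ZMod.intCast_eq_intCast_iff_dvd_sub] at h
    simpa using h.symm
  have hbij : Function.Bijective φ := by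
    refine ⟨hinj, fun v => ?_⟩
    obtain ⟨i, rfl⟩ := hf.surjective hG v
    exact ⟨i, hφ i⟩
  have hcard : Fintype.card V = n + 2 := by
    rw [← Fintype.card_of_bijective hbij, ZMod.card]
  have hadj (z w : ZMod (n + 2)) :
      G.Adj (φ z) (φ w) ↔ w = z - 2 ∨ w = z - 1 ∨ w = z + 1 ∨ w = z + 2 := by
    obtain ⟨i, rfl⟩ := ZMod.intCast_surjective z
    rw [hφ, hf.adj_iff]
    simp only [← hφ, hinj.eq_iff]
    push_cast
    rfl
  rw [hcard]
  refine ⟨RelIso.symm ⟨Equiv.ofBijective φ hbij, fun {z w} => ?_⟩⟩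
  refine (hadj z w).trans ((iff_and_self.2 ?_).trans cycleGraph_square_adj.symm)
  exact fun h hzw => ((hadj z w).2 h).ne (congrArg φ hzw)

end IsSquareLine

end SquareLine

theorem theorem3 :
    ∃ N : ℕ, ∀ (V : Type*) [Fintype V] (G : SimpleGraph V) [DecidableRel G.Adj],
      N ≤ Fintype.card V →
      G.Connected →
      G.IsRegularOfDegree 4 →
      (∃ x : V, ¬ Nonempty (G.induce (G.neighborSet x) ≃g SimpleGraph.twoK2)) →
      (Nonempty (G ≃g (SimpleGraph.cycleGraph (Fintype.card V)).square) ∨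
        ∃ S : Finset V, G.IsMinimalCutset S ∧ S.card ≤ 4 ∧ G.avgDegreeOn S < 1) := by
  refine ⟨9, fun V _ G _ hcard hG hreg ⟨x, hx⟩ => or_iff_not_imp_right.2 fun hsparse => ?_⟩
  have hdense : HasDenseCuts G := fun S hS hS4 => not_lt.1 fun hlt => hsparse ⟨S, hS, hS4, hlt⟩
  have hlinked : WellLinked G := wellLinked hcard hreg hG.preconnected hdense
  obtain ⟨a, b, c, d, hpath⟩ := hlinked.exists_isPathAt hx
  obtain ⟨f, hf⟩ := hlinked.exists_isSquareLine hpath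
  exact hf.nonempty_iso hG.preconnected
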